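/- For sequences $(a_n)_{n\ge 0}$, $(b_n)_{n\ge 1}$ of complex numbers let $$\mathrm{CF}[a_n,b_n]=a_0+\cfrac{b_1}{a_1+\cfrac{b_2}{a_2+\ddots}},$$ that is, the limit in the Riemann sphere of the convergents $A_n/B_n$, where $A_0=1$, $A_1=a_0$, $B_0=0$, $B_1=1$, and $A_{n+1}=a_nA_n+b_nA_{n-1}$, $B_{n+1}=a_nB_n+b_nB_{n-1}$ for $n\ge1$. For complex $\alpha,\beta,\gamma$ put $$H(\alpha,\beta;\gamma)=\frac{1}{\mathrm{CF}\left[\Delta\bigl(n(n+\alpha)(n+\beta)\bigr),\,-2n(n+\alpha)(n+\beta)(n+\gamma)\right]},\qquad \Delta f_n=f_{n+1}-f_n,$$ with $1/\infty=0$; $H(\alpha,\beta;\gamma)$ is called defined if the continued fraction converges in the Riemann sphere to a value other than $0$. **Theorem 2.2.** Let $\alpha,\beta,\gamma\in\mathbb{C}$ be such that $\frac{\alpha+1}{2},\ \frac{\beta+1}{2},\ \gamma+1,\ \frac{\alpha+\beta+1}{2}-\gamma\notin\mathbb{Z}_{\le 0}$. Then $H(\alpha,\beta;\gamma)$ is defined,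 and the following hold. 1. If moreover $\alpha\ne1$ and $\alpha+\beta-2\gamma\neq1$ (equivalently, $(\alpha-2,\beta,\gamma)$ satisfies the same four conditions), then $H(\alpha-2,\beta;\gamma)$ is defined and $$\alpha(\alpha-2\gamma-1)\,H(\alpha,\beta;\gamma)-(\alpha-1)(\alpha+\beta-2\gamma-1)\,H(\alpha-2,\beta;\gamma)+1=0.$$ 2. $H(\alpha,\beta;\gamma-1)$ is defined and $$2\gamma(2\gamma-\alpha-\beta-1)\,H(\alpha,\beta;\gamma)-(2\gamma-\alpha-1)(2\gamma-\beta-1)\,H(\alpha,\beta;\gamma-1)+1=0.$$ -/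

import Mathlib

open Filter Topology

/-- The continued fraction `a 0 + b 1 / (a 1 + b 2 / (a 2 + ⋯))`. (In a Mathlib pair `⟨x, y⟩`
of a `GenContFract`, `x` is the partial numerator and `y` the partial denominator.) -/
def genCF (a b : ℕ → ℂ) : GenContFract ℂ where
  h := a 0
  s := Stream'.Seq.ofStream fun n => ⟨b (n + 1), a (n + 1)⟩

/-- The quotient `p / q` as a point of the Riemann sphere; it is `∞` when `q = 0`. -/
noncomputable def sphereQuot (p q : ℂ) : OnePoint ℂ :=
  open Classical in if q = 0 then OnePoint.infty else ((p / q : ℂ) : OnePoint ℂ)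

/-- The `n`-th convergent of the continued fraction, the quotient of its `n`-th continuants,
as a point of the Riemann sphere. -/
noncomputable def cfConvergent (a b : ℕ → ℂ) (n : ℕ) : OnePoint ℂ :=
  sphereQuot ((genCF a b).nums n) ((genCF a b).dens n)

/-- The continued fraction converges to `v` in the Riemann sphere. -/
def CFConvergesTo (a b : ℕ → ℂ) (v : OnePoint ℂ) : Prop :=
  Tendsto (cfConvergent a b) atTop (𝓝 v)

/-- The value `CF[a_n, b_n]` of the continued fraction (meaningful when it converges). -/
noncomputable def CF (a b : ℕ → ℂ) : OnePoint ℂ :=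
  limUnder atTop (cfConvergent a b)

/-- The reciprocal `1 / v` of a nonzero point of the Riemann sphere, with `1 / ∞ = 0`.
(The value at `v = 0` is a placeholder.) -/
noncomputable def sphereRecip : OnePoint ℂ → ℂ
  | none => 0
  | some z => z⁻¹

/-- `a_n = Δ (n (n + α) (n + β))`, where `Δ f_n = f_{n+1} - f_n`. -/
noncomputable def coeffA (α β : ℂ) : ℕ → ℂ :=
  fwdDiff 1 fun n : ℕ => (n : ℂ) * (n + α) * (n + β)

/-- `b_n = -2 n (n + α) (n + β) (n + γ)`. -/
noncomputable def coeffB (α β γ : ℂ) (n : ℕ) : ℂ :=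
  -2 * n * (n + α) * (n + β) * (n + γ)

/-- `H(α, β; γ)` is a well-defined complex number: the continued fraction
`CF[Δ(n(n+α)(n+β)), -2n(n+α)(n+β)(n+γ)]` converges in the Riemann sphere, and not to `0`. -/
def HIsDefined (α β γ : ℂ) : Prop :=
  ∃ v : OnePoint ℂ, CFConvergesTo (coeffA α β) (coeffB α β γ) v ∧ v ≠ ((0 : ℂ) : OnePoint ℂ)

/-- `H(α, β; γ) = 1 / CF[Δ(n(n+α)(n+β)), -2n(n+α)(n+β)(n+γ)]`. -/
noncomputable def H (α β γ : ℂ) : ℂ :=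
  sphereRecip (CF (coeffA α β) (coeffB α β γ))

/-!
The numerators `A` and denominators `B` of the convergents solve
`X (n + 2) = a (n + 1) X (n + 1) + b (n + 1) X n`. After division by `(n!) ^ 2` the coefficients
tend to `3` and `-2`, so the limiting characteristic roots are `1` and `2`: a solution is either
slow (it is `O(ρ ^ n)` for some `ρ < 2`) or dominant, with ratios tending to `2`
(`isSlow_or_tendsto_ratio`). If `A` is dominant, then `B / A` converges to a number `h`, and `h` is
characterised by the slowness of `B - h A` (`exists_tendsto_div_and_isSlow_sub`, a form of
Pincherle's theorem). As points of the sphere the convergents `A / B` then tend to `1 / h`, which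
is nonzero, so `H` is defined and equal to `h` (`hIsDefined_of_not_isSlow`).

The contiguity relations come from operators `X n ↦ X (n + 1) + g n X n`, with `g` a polynomial,
that carry the solutions for `(α, β, γ)` to those for `(α + 2, β, γ)` or `(α, β, γ + 1)`. Comparing
initial values shows that such an operator sends the old `A'` to `s A` and the old `B'` to `A + t B`,
where `s` and `t` are the coefficients of the stated relation. It preserves slowness, so it
sends `B' - h' A'` to a slow solution; dominance of `A` then forces `t h - s h' + 1 = 0`
(`relation_of_shiftOp`).

It remains to see that `A` is dominant (`not_isSlow_numerH`). If `A` were slow, it would remain slow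
when `α` and `β` are increased by even integers, since the factors `s` of these steps do not vanish
under the hypotheses. But for `α` and `β` of large real part Worpitzky's criterion gives
`‖A (n + 1)‖ ≥ ‖a n‖ ‖A n‖ / 2`, which is of order `(3 / 2) n ^ 2 ‖A n‖` and rules out slowness
(`exists_not_isSlow_numerH_add`).
-/

open Asymptotics

/-! ### Solutions of a recurrence with characteristic roots `1` and `2` -/

/-- A sequence bounded by a multiple of `ρ ^ n` for some `ρ < 2`, that is, of exponential rate
strictly smaller than that of a dominant solution. -/
def IsSlow (x : ℕ → ℂ) : Prop :=
  ∃ ρ : ℝ, 0 < ρ ∧ ρ < 2 ∧ x =O[atTop] fun n => ρ ^ n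

theorem isBigO_pow_of_norm_succ_le {x : ℕ → ℂ} {ρ : ℝ} (hρ : 0 < ρ)
    (h : ∀ᶠ n in atTop, ‖x (n + 1)‖ ≤ ρ * ‖x n‖) : x =O[atTop] fun n => ρ ^ n := by
  obtain ⟨N, hN⟩ := eventually_atTop.1 h
  refine isBigO_iff.2 ⟨‖x N‖ / ρ ^ N, eventually_atTop.2 ⟨N, fun n hn => ?_⟩⟩
  obtain ⟨k, rfl⟩ := Nat.exists_eq_add_of_le hn
  have key : ∀ k, ‖x (N + k)‖ ≤ ‖x N‖ * ρ ^ k := by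
    intro k
    induction k with
    | zero => simp
    | succ k ih =>
      calc ‖x (N + k + 1)‖ ≤ ρ * ‖x (N + k)‖ := hN _ (by omega)
        _ ≤ ρ * (‖x N‖ * ρ ^ k) := by gcongr
        _ = ‖x N‖ * ρ ^ (k + 1) := by ring
  refine (key k).trans (le_of_eq ?_)
  rw [Real.norm_of_nonneg (by positivity), pow_add]
  field_simp

theorem pow_isBigO_of_le_norm_succ {x : ℕ → ℂ} {t : ℝ} (ht : 0 < t)
    (h0 : ∀ᶠ n in atTop, x n ≠ 0) (h : ∀ᶠ n in atTop, t * ‖x n‖ ≤ ‖x (n + 1)‖) :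
    (fun n => t ^ n) =O[atTop] x := by
  have h1 : (fun n => (x n)⁻¹) =O[atTop] fun n => t⁻¹ ^ n := by
    refine isBigO_pow_of_norm_succ_le (inv_pos.2 ht) ?_
    filter_upwards [h, h0] with n hn hn0
    rw [norm_inv, norm_inv, ← mul_inv]
    have : 0 < ‖x n‖ := norm_pos_iff.2 hn0
    gcongr
  have h2 := h1.inv_rev (by filter_upwards [h0] with n hn h; simp_all)
  simpa using h2

theorem not_isBigO_pow_of_le_norm_succ {x : ℕ → ℂ} {ρ t : ℝ} (hρ : 0 < ρ) (ht : ρ < t)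
    (h0 : ∀ᶠ n in atTop, x n ≠ 0) (h : ∀ᶠ n in atTop, t * ‖x n‖ ≤ ‖x (n + 1)‖) :
    ¬ x =O[atTop] fun n => ρ ^ n := by
  intro hx
  have h1 := (pow_isBigO_of_le_norm_succ (hρ.trans ht) h0 h).trans hx
  have h2 := h1.trans_isLittleO (isLittleO_pow_pow_of_lt_left hρ.le ht)
  exact isLittleO_irrefl (Frequently.of_forall fun n => by
    have := hρ.trans ht; positivity) h2

theorem eventually_norm_succ_bounds {x : ℕ → ℂ} {c : ℂ} (h0 : ∀ᶠ n in atTop, x n ≠ 0)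
    (h : Tendsto (fun n => x (n + 1) / x n) atTop (𝓝 c)) {s t : ℝ} (hs : s < ‖c‖) (ht : ‖c‖ < t) :
    ∀ᶠ n in atTop, s * ‖x n‖ ≤ ‖x (n + 1)‖ ∧ ‖x (n + 1)‖ ≤ t * ‖x n‖ := by
  filter_upwards [h.norm.eventually_const_lt hs, h.norm.eventually_lt_const ht, h0] with n h1 h2 h3
  have : 0 < ‖x n‖ := norm_pos_iff.2 h3
  rw [norm_div] at h1 h2
  exact ⟨((lt_div_iff₀ this).1 h1).le, ((div_lt_iff₀ this).1 h2).le⟩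

theorem not_isSlow_of_tendsto_ratio {x : ℕ → ℂ} (h0 : ∀ᶠ n in atTop, x n ≠ 0)
    (h : Tendsto (fun n => x (n + 1) / x n) atTop (𝓝 2)) : ¬ IsSlow x := by
  rintro ⟨ρ, hρ, hρ2, hx⟩
  obtain ⟨t, ht, ht2⟩ := exists_between hρ2
  refine not_isBigO_pow_of_le_norm_succ hρ ht h0 ?_ hx
  filter_upwards [eventually_norm_succ_bounds h0 h (s := t) (t := 3) (by simpa using ht2) (by norm_num)] with n hn
  exact hn.1

theorem IsSlow.add {x y : ℕ → ℂ} (hx : IsSlow x) (hy : IsSlow y) :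
    IsSlow fun n => x n + y n := by
  obtain ⟨ρ, hρ, hρ2, hx⟩ := hx
  obtain ⟨σ, hσ, hσ2, hy⟩ := hy
  refine ⟨max ρ σ, lt_max_of_lt_left hρ, max_lt hρ2 hσ2, IsBigO.add (hx.trans ?_) (hy.trans ?_)⟩
  · exact IsBigO.of_bound 1 (Eventually.of_forall fun n => by
      rw [Real.norm_of_nonneg (by positivity), Real.norm_of_nonneg (by positivity), one_mul]
      gcongr; exact le_max_left _ _)
  · exact IsBigO.of_bound 1 (Eventually.of_forall fun n => by
      rw [Real.norm_of_nonneg (by positivity), Real.norm_of_nonneg (by positivity), one_mul]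
      gcongr; exact le_max_right _ _)

theorem IsSlow.succ {x : ℕ → ℂ} (hx : IsSlow x) : IsSlow fun n => x (n + 1) := by
  obtain ⟨ρ, hρ, hρ2, hx⟩ := hx
  refine ⟨ρ, hρ, hρ2, (hx.comp_tendsto (tendsto_add_atTop_nat 1)).trans ?_⟩
  refine IsBigO.of_bound ρ (Eventually.of_forall fun n => ?_)
  simp [pow_succ, mul_comm, abs_of_pos hρ]

theorem IsSlow.mul_isBigO {x g : ℕ → ℂ} (hx : IsSlow x) {k : ℕ}
    (hg : g =O[atTop] fun n => (n : ℝ) ^ k) : IsSlow fun n => g n * x n := by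
  obtain ⟨ρ, hρ, hρ2, hx⟩ := hx
  obtain ⟨t, ht, ht2⟩ := exists_between hρ2
  refine ⟨t, hρ.trans ht, ht2, (hg.mul hx).trans ?_⟩
  have h1 : (1 : ℝ) < t / ρ := (one_lt_div hρ).2 ht
  have h2 := (isLittleO_pow_const_const_pow_of_one_lt (R := ℝ) k h1).isBigO.mul
    (isBigO_refl (fun n : ℕ => ρ ^ n) atTop)
  refine h2.congr_right fun n => ?_
  rw [← mul_pow, div_mul_cancel₀ _ hρ.ne']

theorem IsSlow.const_mul {x : ℕ → ℂ} (hx : IsSlow x) (c : ℂ) : IsSlow fun n => c * x n :=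
  hx.mul_isBigO (k := 0) (by simpa using isBigO_const_const c (one_ne_zero (α := ℝ)) atTop)

theorem tendsto_zero_of_le_mul_add {u ε : ℕ → ℝ} {θ : ℝ} (hθ0 : 0 ≤ θ) (hθ : θ < 1)
    (hu : ∀ n, 0 ≤ u n) (hε : Tendsto ε atTop (𝓝 0))
    (h : ∀ᶠ n in atTop, u (n + 1) ≤ θ * u n + ε n) : Tendsto u atTop (𝓝 0) := by
  refine tendsto_order.2 ⟨fun a ha => Eventually.of_forall fun n => ha.trans_le (hu n),
    fun δ hδ => ?_⟩
  have hpos : 0 < (1 - θ) * (δ / 2) := mul_pos (by linarith) (by linarith)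
  obtain ⟨N, hN⟩ := eventually_atTop.1 (h.and (hε.eventually_lt_const hpos))
  have key : ∀ k, u (N + k) - δ / 2 ≤ θ ^ k * u N := by
    intro k
    induction k with
    | zero => simp; linarith
    | succ k ih =>
      obtain ⟨h1, h2⟩ := hN (N + k) (by omega)
      have h3 := mul_le_mul_of_nonneg_left ih hθ0
      rw [pow_succ, ← add_assoc]
      nlinarith
  have hlim : Tendsto (fun k => θ ^ k * u N) atTop (𝓝 0) := by
    simpa using (tendsto_pow_atTop_nhds_zero_of_lt_one hθ0 hθ).mul_const (u N)
  obtain ⟨K, hK⟩ := eventually_atTop.1 (hlim.eventually_lt_const (half_pos hδ))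
  refine eventually_atTop.2 ⟨N + K, fun n hn => ?_⟩
  obtain ⟨k, rfl⟩ := Nat.exists_eq_add_of_le hn
  have h1 := hK (K + k) (by omega)
  have h2 := key (K + k)
  rw [← add_assoc] at h2
  linarith

/-- Poincaré's theorem in the case at hand: since the limiting characteristic polynomial
`X ^ 2 - 3 X + 2` has the roots `1` and `2`, a solution either stays slow
or has consecutive ratios tending to `2`. -/
theorem isSlow_or_tendsto_ratio {p q x : ℕ → ℂ} (hp : Tendsto p atTop (𝓝 3))
    (hq : Tendsto q atTop (𝓝 (-2))) (hx : ∀ n, x (n + 2) = p n * x (n + 1) + q n * x n) :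
    (x =O[atTop] fun n => (7 / 5 : ℝ) ^ n) ∨
      ((∀ᶠ n in atTop, x n ≠ 0) ∧ Tendsto (fun n => x (n + 1) / x n) atTop (𝓝 2)) := by
  by_cases hs : ∀ᶠ n in atTop, ‖x (n + 1)‖ ≤ 7 / 5 * ‖x n‖
  · exact Or.inl (isBigO_pow_of_norm_succ_le (by norm_num) hs)
  right
  have hp0 : Tendsto (fun n => ‖p n - 3‖) atTop (𝓝 0) := by
    simpa using (hp.sub_const 3).norm
  have hq0 : Tendsto (fun n => ‖q n + 2‖) atTop (𝓝 0) := by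
    simpa using (hq.add_const 2).norm
  obtain ⟨N, hN⟩ := eventually_atTop.1 ((hp0.eventually_lt_const (u := 1 / 20) (by norm_num)).and
    (hq0.eventually_lt_const (u := 1 / 20) (by norm_num)))
  obtain ⟨M, hM, hMs⟩ := (not_eventually.1 hs).forall_exists_of_atTop N
  -- Once the ratio exceeds `7 / 5` it does so forever: `59 / 20 - (41 / 20) / (7 / 5) > 7 / 5`.
  have grow : ∀ n ≥ M, 7 / 5 * ‖x n‖ < ‖x (n + 1)‖ := by
    intro n hn
    induction n, hn using Nat.le_induction with
    | base => exact not_le.1 hMs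
    | succ n hn ih =>
      obtain ⟨h1, h2⟩ := hN n (by omega)
      have e : 3 * x (n + 1) = x (n + 2) - (p n - 3) * x (n + 1) - (q n + 2) * x n + 2 * x n := by
        rw [hx]; ring
      have b : 3 * ‖x (n + 1)‖ ≤ ‖x (n + 2)‖ + ‖p n - 3‖ * ‖x (n + 1)‖ + ‖q n + 2‖ * ‖x n‖
          + 2 * ‖x n‖ := by
        calc 3 * ‖x (n + 1)‖ = ‖3 * x (n + 1)‖ := by simp
          _ ≤ _ := by
            rw [e]
            refine (norm_add_le _ _).trans ?_
            refine add_le_add ((norm_sub_le _ _).trans ?_) (by simp)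
            exact add_le_add ((norm_sub_le _ _).trans (by simp)) (by simp)
      have n0 := norm_nonneg (x n)
      have n1 := norm_nonneg (x (n + 1))
      have c1 := mul_le_mul_of_nonneg_right h1.le n1
      have c2 := mul_le_mul_of_nonneg_right h2.le n0
      change 7 / 5 * ‖x (n + 1)‖ < ‖x (n + 2)‖
      linarith
  have ne : ∀ n ≥ M + 1, x n ≠ 0 := by
    intro n hn
    obtain ⟨k, rfl⟩ := Nat.exists_eq_add_of_le hn
    have := grow (M + k) (by omega)
    rw [← norm_pos_iff]
    have e : M + 1 + k = M + k + 1 := by ring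
    rw [e]
    exact lt_of_le_of_lt (by positivity) this
  refine ⟨eventually_atTop.2 ⟨M + 1, ne⟩, ?_⟩
  rw [tendsto_iff_norm_sub_tendsto_zero]
  refine tendsto_zero_of_le_mul_add (θ := 5 / 7) (ε := fun n => ‖p n - 3‖ + ‖q n + 2‖)
    (by norm_num) (by norm_num) (fun n => norm_nonneg _) (by simpa using hp0.add hq0) ?_
  refine eventually_atTop.2 ⟨M + 1, fun n hn => ?_⟩
  have hn0 := ne n hn
  have hn1 := ne (n + 1) (by omega)
  have hr : ‖x n / x (n + 1)‖ ≤ 5 / 7 := by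
    rw [norm_div, div_le_iff₀ (norm_pos_iff.2 hn1)]
    have := grow n (by omega)
    linarith
  have e : x (n + 1 + 1) / x (n + 1) - 2
      = x n / x (n + 1) * (x (n + 1) / x n - 2) + ((p n - 3) + (q n + 2) * (x n / x (n + 1))) := by
    rw [show n + 1 + 1 = n + 2 from rfl, hx]
    field_simp
    ring
  rw [e]
  refine (norm_add_le _ _).trans (add_le_add ?_ ((norm_add_le _ _).trans (add_le_add le_rfl ?_)))
  · rw [norm_mul]; gcongr
  · rw [norm_mul]
    exact mul_le_of_le_one_right (norm_nonneg _) (hr.trans (by norm_num))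

/-- The quotients of a solution `y` by a dominant solution `x` converge, and subtracting the
corresponding multiple of `x` from `y` leaves a slow solution. The reason is that the Casoratian
`y (n + 1) x n - y n x (n + 1)` is multiplied by `-q n`, hence roughly by `2`, at each step. -/
theorem exists_tendsto_div_and_isSlow_sub {p q x y : ℕ → ℂ} (hq : Tendsto q atTop (𝓝 (-2)))
    (hx : ∀ n, x (n + 2) = p n * x (n + 1) + q n * x n)
    (hy : ∀ n, y (n + 2) = p n * y (n + 1) + q n * y n)
    (h0 : ∀ᶠ n in atTop, x n ≠ 0) (h2 : Tendsto (fun n => x (n + 1) / x n) atTop (𝓝 2)) :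
    ∃ h : ℂ, Tendsto (fun n => y n / x n) atTop (𝓝 h) ∧ IsSlow fun n => y n - h * x n := by
  set e : ℕ → ℂ := fun n => y n / x n with he
  set d : ℕ → ℂ := fun n => e (n + 1) - e n with hd
  have h01 := (tendsto_add_atTop_nat 1).eventually h0
  have h02 := (tendsto_add_atTop_nat 2).eventually h0
  have hstep : ∀ᶠ n in atTop, d (n + 1) =
      -q n * ((x (n + 1) / x n)⁻¹ * (x (n + 2) / x (n + 1))⁻¹) * d n := by
    filter_upwards [h0, h01, h02] with n a0 a1 a2
    have a2' : x (n + 1 + 1) ≠ 0 := a2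
    have c1 : x (n + 1 + 1) = p n * x (n + 1) + q n * x n := hx n
    have c2 : y (n + 1 + 1) = p n * y (n + 1) + q n * y n := hy n
    simp only [hd, he]
    rw [show n + 2 = n + 1 + 1 from rfl]
    field_simp
    rw [c1, c2]
    ring
  have hfac : Tendsto (fun n => ‖-q n * ((x (n + 1) / x n)⁻¹ * (x (n + 2) / x (n + 1))⁻¹)‖) atTop
      (𝓝 (1 / 2)) := by
    have t1 := h2.inv₀ two_ne_zero
    have t2 := t1.comp (tendsto_add_atTop_nat 1)
    have := (hq.neg.mul (t1.mul t2)).norm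
    simpa using this
  have hdO : d =O[atTop] fun n => (11 / 20 : ℝ) ^ n := by
    refine isBigO_pow_of_norm_succ_le (by norm_num) ?_
    filter_upwards [hstep, hfac.eventually_lt_const (u := 11 / 20) (by norm_num)] with n h1 h2
    rw [h1, norm_mul]
    gcongr
  obtain ⟨C, hC⟩ := isBigO_iff.1 hdO
  obtain ⟨N, hN⟩ := eventually_atTop.1 hC
  have hgeo : ∀ n, dist (e (N + n)) (e (N + (n + 1))) ≤ C * (11 / 20) ^ N * (11 / 20 : ℝ) ^ n := by
    intro n
    have := hN (N + n) (by omega)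
    rw [dist_comm, dist_eq_norm, mul_assoc, ← pow_add]
    simpa [hd, ← add_assoc] using this
  obtain ⟨h, hh⟩ := cauchySeq_tendsto_of_complete
    (cauchySeq_of_le_geometric _ _ (by norm_num) hgeo)
  have hlim : Tendsto e atTop (𝓝 h) := by
    have hh' : Tendsto (fun n => e (n + N)) atTop (𝓝 h) := by simpa only [add_comm N] using hh
    exact (tendsto_add_atTop_iff_nat N).1 hh'
  refine ⟨h, hlim, 231 / 200, by norm_num, by norm_num, ?_⟩
  have hb : (fun n => e n - h) =O[atTop] fun n => (11 / 20 : ℝ) ^ n := by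
    refine isBigO_iff.2 ⟨C / (1 - 11 / 20), eventually_atTop.2 ⟨N, fun n hn => ?_⟩⟩
    obtain ⟨k, rfl⟩ := Nat.exists_eq_add_of_le hn
    have := dist_le_of_le_geometric_of_tendsto _ _ (by norm_num) hgeo hh k
    rw [dist_eq_norm] at this
    refine this.trans (le_of_eq ?_)
    rw [Real.norm_of_nonneg (by positivity), pow_add]
    ring
  have hxO : x =O[atTop] fun n => (21 / 10 : ℝ) ^ n := by
    refine isBigO_pow_of_norm_succ_le (by norm_num) ?_
    filter_upwards [eventually_norm_succ_bounds h0 h2 (s := 1) (t := 21 / 10) (by norm_num) (by norm_num)]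
      with n hn using hn.2
  have := hb.mul hxO
  refine (this.congr_right fun n => ?_).congr' ?_ EventuallyEq.rfl
  · rw [← mul_pow]; norm_num
  · filter_upwards [h0] with n hn
    simp only [he]
    field_simp

/-! ### Continuants and convergence in the Riemann sphere -/

/-- The solution of `X (n + 2) = a (n + 1) X (n + 1) + b (n + 1) X n` with initial values
`X 0 = x₀` and `X 1 = x₁`. The numerators and denominators of the convergents are the solutions
with initial values `1, a 0` and `0, 1`, shifted by one index. -/
def recSol (a b : ℕ → ℂ) (x₀ x₁ : ℂ) : ℕ → ℂ
  | 0 => x₀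
  | 1 => x₁
  | n + 2 => a (n + 1) * recSol a b x₀ x₁ (n + 1) + b (n + 1) * recSol a b x₀ x₁ n

theorem genCF_get? (a b : ℕ → ℂ) (n : ℕ) :
    (genCF a b).s.get? n = some ⟨b (n + 1), a (n + 1)⟩ := rfl

theorem genCF_nums (a b : ℕ → ℂ) (n : ℕ) :
    (genCF a b).nums n = recSol a b 1 (a 0) (n + 1) := by
  induction n using Nat.twoStepInduction with
  | zero => exact GenContFract.zeroth_num_eq_h
  | one =>
    rw [GenContFract.first_num_eq (genCF_get? a b 0)]
    simp [recSol, genCF]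
  | more n ih1 ih2 =>
    rw [GenContFract.nums_recurrence (genCF_get? a b (n + 1)) rfl rfl, ih1, ih2]
    rfl

theorem genCF_dens (a b : ℕ → ℂ) (n : ℕ) :
    (genCF a b).dens n = recSol a b 0 1 (n + 1) := by
  induction n using Nat.twoStepInduction with
  | zero => exact GenContFract.zeroth_den_eq_one
  | one =>
    rw [GenContFract.first_den_eq (genCF_get? a b 0)]
    simp [recSol]
  | more n ih1 ih2 =>
    rw [GenContFract.dens_recurrence (genCF_get? a b (n + 1)) rfl rfl, ih1, ih2]
    rfl

/-- The inversion `w ↦ 1 / w` from the plane to the Riemann sphere, with `1 / 0 = ∞`. -/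
noncomputable def sphereInv (w : ℂ) : OnePoint ℂ :=
  sphereQuot 1 w

theorem sphereQuot_eq_sphereInv {p : ℂ} (hp : p ≠ 0) (q : ℂ) :
    sphereQuot p q = sphereInv (q / p) := by
  by_cases hq : q = 0 <;> simp [sphereInv, sphereQuot, hq, hp]

theorem sphereInv_ne_zero (w : ℂ) : sphereInv w ≠ ((0 : ℂ) : OnePoint ℂ) := by
  by_cases hw : w = 0
  · simp [sphereInv, sphereQuot, hw]
  · simp [sphereInv, sphereQuot, hw]

theorem sphereRecip_sphereInv (w : ℂ) : sphereRecip (sphereInv w) = w := by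
  by_cases hw : w = 0
  · simp only [sphereInv, sphereQuot, hw, if_true]
    rfl
  · simp only [sphereInv, sphereQuot, hw, if_false]
    change (1 / w)⁻¹ = w
    simp

theorem continuous_sphereInv : Continuous sphereInv := by
  refine continuous_iff_continuousAt.2 fun w => ?_
  by_cases hw : w = 0
  · subst hw
    have h0 : sphereInv 0 = OnePoint.infty := by simp [sphereInv, sphereQuot]
    rw [ContinuousAt, h0, ← pure_sup_nhdsNE, tendsto_sup]
    refine ⟨by rw [tendsto_pure_left]; intro s hs; rw [h0]; exact mem_of_mem_nhds hs, ?_⟩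
    have h1 : Tendsto (fun z : ℂ => ((z⁻¹ : ℂ) : OnePoint ℂ)) (𝓝[≠] 0) (𝓝 OnePoint.infty) := by
      refine OnePoint.tendsto_coe_infty.comp ?_
      rw [coclosedCompact_eq_cocompact, ← Metric.cobounded_eq_cocompact]
      exact tendsto_inv₀_nhdsNE_zero
    refine h1.congr' ?_
    filter_upwards [self_mem_nhdsWithin] with z hz
    simp only [sphereInv, sphereQuot, one_div]
    exact (if_neg hz).symm
  · have h1 : ContinuousAt (fun z : ℂ => ((z⁻¹ : ℂ) : OnePoint ℂ)) w :=
      OnePoint.continuous_coe.continuousAt.comp (continuousAt_inv₀ hw)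
    refine h1.congr ?_
    filter_upwards [isOpen_ne.mem_nhds hw] with z hz
    simp only [sphereInv, sphereQuot, one_div]
    exact (if_neg hz).symm

theorem cfConvergesTo_sphereInv {a b : ℕ → ℂ} {h : ℂ}
    (h0 : ∀ᶠ n in atTop, recSol a b 1 (a 0) n ≠ 0)
    (hh : Tendsto (fun n => recSol a b 0 1 n / recSol a b 1 (a 0) n) atTop (𝓝 h)) :
    CFConvergesTo a b (sphereInv h) := by
  have h1 := ((continuous_sphereInv.tendsto h).comp hh).comp (tendsto_add_atTop_nat 1)
  refine h1.congr' ?_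
  filter_upwards [(tendsto_add_atTop_nat 1).eventually h0] with n hn
  simp only [cfConvergent, genCF_nums, genCF_dens, Function.comp]
  rw [sphereQuot_eq_sphereInv hn]

/-! ### The recurrence attached to `H` -/

/-- The sequence `X` solves the recurrence of the continued fraction with partial denominators `a`
and partial numerators `b`. -/
def IsRecSol (a b X : ℕ → ℂ) : Prop :=
  ∀ n, X (n + 2) = a (n + 1) * X (n + 1) + b (n + 1) * X n

theorem isRecSol_recSol (a b : ℕ → ℂ) (x₀ x₁ : ℂ) : IsRecSol a b (recSol a b x₀ x₁) :=
  fun _ => rfl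

theorem IsRecSol.ext {a b X Y : ℕ → ℂ} (hX : IsRecSol a b X) (hY : IsRecSol a b Y)
    (h0 : X 0 = Y 0) (h1 : X 1 = Y 1) : X = Y := by
  funext n
  induction n using Nat.twoStepInduction with
  | zero => exact h0
  | one => exact h1
  | more n ih1 ih2 => rw [hX n, hY n, ih1, ih2]

theorem IsRecSol.add {a b X Y : ℕ → ℂ} (hX : IsRecSol a b X) (hY : IsRecSol a b Y) :
    IsRecSol a b fun n => X n + Y n := fun n => by
  simp only [hX n, hY n]; ring

theorem IsRecSol.const_mul {a b X : ℕ → ℂ} (hX : IsRecSol a b X) (c : ℂ) :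
    IsRecSol a b fun n => c * X n := fun n => by
  simp only [hX n]; ring

/-- The sequence `X` divided by `(n!) ^ 2`; this turns the recurrence of `H` into one whose
coefficients converge. -/
noncomputable def factScaled (X : ℕ → ℂ) (n : ℕ) : ℂ :=
  X n / (n.factorial : ℂ) ^ 2

theorem coeffA_apply (α β : ℂ) (n : ℕ) :
    coeffA α β n = (n + 1) * (n + 1 + α) * (n + 1 + β) - n * (n + α) * (n + β) := by
  simp [coeffA, fwdDiff]

theorem coeffB_apply (α β γ : ℂ) (n : ℕ) :
    coeffB α β γ n = -2 * n * (n + α) * (n + β) * (n + γ) := rfl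

theorem tendsto_natCast_add_div (z w : ℂ) :
    Tendsto (fun n : ℕ => ((n : ℂ) + z) / (n + w)) atTop (𝓝 1) := by
  have hinv : Tendsto (fun n : ℕ => ((n : ℂ))⁻¹) atTop (𝓝 0) := tendsto_inv_atTop_nhds_zero_nat
  have h1 : Tendsto (fun n : ℕ => (1 + z * (n : ℂ)⁻¹) / (1 + w * (n : ℂ)⁻¹)) atTop (𝓝 1) := by
    have := ((hinv.const_mul z).const_add 1).div ((hinv.const_mul w).const_add 1) (by simp)
    simpa [Pi.div_def] using this
  refine h1.congr' ?_
  filter_upwards [eventually_ne_atTop 0] with n hn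
  have : (n : ℂ) ≠ 0 := by exact_mod_cast hn
  rw [← mul_div_mul_left (1 + z * (n : ℂ)⁻¹) _ this]
  congr 1 <;> field_simp

theorem tendsto_coeffA_scaled (α β : ℂ) :
    Tendsto (fun n : ℕ => coeffA α β (n + 1) / ((n : ℂ) + 2) ^ 2) atTop (𝓝 3) := by
  have t := fun z => tendsto_natCast_add_div z 2
  have tinv : Tendsto (fun n : ℕ => 1 / ((n : ℂ) + 2)) atTop (𝓝 0) := by
    have := ((t 3).sub (t 2))
    simp only [← sub_div] at this
    simpa [show (3 : ℂ) - 2 = 1 by norm_num] using this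
  have h := (((t (2 + α)).mul (t (2 + β))).add ((t 1).mul ((t (2 + β)).add (t (1 + α))))).add
    (((t 1).mul tinv).mul_const (0 : ℂ))
  refine (h.congr fun n => ?_).trans (by norm_num)
  have : (n : ℂ) + 2 ≠ 0 := by exact_mod_cast (by omega : n + 2 ≠ 0)
  rw [coeffA_apply]
  push_cast
  field_simp
  ring

theorem tendsto_coeffB_scaled (α β γ : ℂ) :
    Tendsto (fun n : ℕ => coeffB α β γ (n + 1) / (((n : ℂ) + 2) ^ 2 * ((n : ℂ) + 1) ^ 2))
      atTop (𝓝 (-2)) := by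
  have t := tendsto_natCast_add_div
  have h := (((t 1 2).mul (t (1 + α) 2)).mul ((t (1 + β) 1).mul (t (1 + γ) 1))).const_mul (-2 : ℂ)
  refine (h.congr fun n => ?_).trans (by norm_num)
  have h1 : (n : ℂ) + 2 ≠ 0 := by exact_mod_cast (by omega : n + 2 ≠ 0)
  have h2 : (n : ℂ) + 1 ≠ 0 := by exact_mod_cast (by omega : n + 1 ≠ 0)
  rw [coeffB_apply]
  push_cast
  field_simp
  ring

theorem IsRecSol.factScaled {a b X : ℕ → ℂ} (hX : IsRecSol a b X) (n : ℕ) :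
    factScaled X (n + 2) = a (n + 1) / ((n : ℂ) + 2) ^ 2 * factScaled X (n + 1)
      + b (n + 1) / (((n : ℂ) + 2) ^ 2 * ((n : ℂ) + 1) ^ 2) * factScaled X n := by
  have h1 : (n : ℂ) + 2 ≠ 0 := by exact_mod_cast (by omega : n + 2 ≠ 0)
  have h2 : (n : ℂ) + 1 ≠ 0 := by exact_mod_cast (by omega : n + 1 ≠ 0)
  have h3 : (n.factorial : ℂ) ≠ 0 := by exact_mod_cast n.factorial_ne_zero
  simp only [_root_.factScaled, Nat.factorial_succ, hX n]
  push_cast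
  rw [show (n : ℂ) + 1 + 1 = n + 2 by ring]
  field_simp

/-- The numerators of the convergents in the definition of `H`. -/
noncomputable def numerH (α β γ : ℂ) : ℕ → ℂ :=
  recSol (coeffA α β) (coeffB α β γ) 1 (coeffA α β 0)

/-- The denominators of the convergents in the definition of `H`. -/
noncomputable def denomH (α β γ : ℂ) : ℕ → ℂ :=
  recSol (coeffA α β) (coeffB α β γ) 0 1

/-- If the numerators are a dominant solution, then `H` is defined, and it is the number
for which `denomH - H * numerH` is a slow solution. -/
theorem hIsDefined_of_not_isSlow {α β γ : ℂ} (hs : ¬ IsSlow (factScaled (numerH α β γ))) :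
    HIsDefined α β γ ∧
      IsSlow (factScaled fun n => denomH α β γ n - H α β γ * numerH α β γ n) := by
  have hA : IsRecSol (coeffA α β) (coeffB α β γ) (numerH α β γ) := isRecSol_recSol _ _ _ _
  have hB : IsRecSol (coeffA α β) (coeffB α β γ) (denomH α β γ) := isRecSol_recSol _ _ _ _
  have hq := tendsto_coeffB_scaled α β γ
  obtain ⟨h0, h2⟩ := (isSlow_or_tendsto_ratio (tendsto_coeffA_scaled α β) hq
    hA.factScaled).resolve_left fun h => hs ⟨7 / 5, by norm_num, by norm_num, h⟩
  obtain ⟨h, hlim, hslow⟩ := exists_tendsto_div_and_isSlow_sub hq hA.factScaled hB.factScaled h0 h2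
  have hfac : ∀ n : ℕ, (n.factorial : ℂ) ^ 2 ≠ 0 := fun n => by
    exact_mod_cast pow_ne_zero 2 n.factorial_ne_zero
  have hconv : CFConvergesTo (coeffA α β) (coeffB α β γ) (sphereInv h) := by
    refine cfConvergesTo_sphereInv ?_ (hlim.congr fun n => ?_)
    · filter_upwards [h0] with n hn h0
      exact hn (by simp [factScaled, numerH, h0])
    · exact div_div_div_cancel_right₀ (hfac n) _ _
  have hH : H α β γ = h := by
    rw [H, CF, Tendsto.limUnder_eq hconv, sphereRecip_sphereInv]
  refine ⟨⟨_, hconv, sphereInv_ne_zero h⟩, ?_⟩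
  rw [hH]
  convert hslow using 2 with n
  simp only [factScaled]
  ring

/-! ### Contiguity operators -/

/-- The operator `X n ↦ X (n + 1) + g n X n`. For suitable polynomials `g` it carries the solutions
of the recurrence of `H` to those for contiguous parameters (the Bauer–Muir transformation). -/
def shiftOp (g X : ℕ → ℂ) (n : ℕ) : ℂ :=
  X (n + 1) + g n * X n

/-- The coefficient for which `shiftOp` carries the parameters `(α, β, γ)` to `(α + 2, β, γ)`. -/
noncomputable def raiseCoeff (α β γ : ℂ) (n : ℕ) : ℂ :=
  2 * n ^ 2 + 2 * (α + β - γ + 1) * n + (α + 1) * (α + β - 2 * γ + 1) - coeffA α β n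

/-- The coefficient for which `shiftOp` carries the parameters `(α, β, γ)` to `(α, β, γ + 1)`. -/
noncomputable def raiseCoeff' (α β γ : ℂ) (n : ℕ) : ℂ :=
  n ^ 2 + (2 * γ + 1) * n + (2 * γ - α + 1) * (2 * γ - β + 1) - coeffA α β n

theorem IsRecSol.shiftOp_raiseCoeff {α β γ : ℂ} {X : ℕ → ℂ}
    (hX : IsRecSol (coeffA α β) (coeffB α β γ) X) :
    IsRecSol (coeffA (α + 2) β) (coeffB (α + 2) β γ) (shiftOp (raiseCoeff α β γ) X) := by
  intro n
  have h1 : X (n + 2 + 1) = _ := hX (n + 1)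
  have h2 : X (n + 1 + 1) = _ := hX n
  simp only [shiftOp]
  rw [h1, show n + 1 + 1 = n + 2 from rfl] at *
  rw [h2]
  simp only [raiseCoeff, coeffA_apply, coeffB_apply]
  push_cast
  ring

theorem IsRecSol.shiftOp_raiseCoeff' {α β γ : ℂ} {X : ℕ → ℂ}
    (hX : IsRecSol (coeffA α β) (coeffB α β γ) X) :
    IsRecSol (coeffA α β) (coeffB α β (γ + 1)) (shiftOp (raiseCoeff' α β γ) X) := by
  intro n
  have h1 : X (n + 2 + 1) = _ := hX (n + 1)
  have h2 : X (n + 1 + 1) = _ := hX n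
  simp only [shiftOp]
  rw [h1, show n + 1 + 1 = n + 2 from rfl] at *
  rw [h2]
  simp only [raiseCoeff', coeffA_apply, coeffB_apply]
  push_cast
  ring

theorem isRecSol_numerH (α β γ : ℂ) :
    IsRecSol (coeffA α β) (coeffB α β γ) (numerH α β γ) :=
  isRecSol_recSol _ _ _ _

theorem isRecSol_denomH (α β γ : ℂ) :
    IsRecSol (coeffA α β) (coeffB α β γ) (denomH α β γ) :=
  isRecSol_recSol _ _ _ _

theorem shiftOp_numerH (α β γ : ℂ) : shiftOp (raiseCoeff α β γ) (numerH α β γ) =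
    fun n => (α + 1) * (α + β - 2 * γ + 1) * numerH (α + 2) β γ n := by
  refine (isRecSol_numerH _ _ _).shiftOp_raiseCoeff.ext ((isRecSol_numerH _ _ _).const_mul _) ?_ ?_ <;>
  · simp [shiftOp, raiseCoeff, numerH, recSol, coeffA_apply, coeffB_apply]
    try ring

theorem shiftOp_denomH (α β γ : ℂ) : shiftOp (raiseCoeff α β γ) (denomH α β γ) =
    fun n => numerH (α + 2) β γ n + (α + 2) * (α - 2 * γ + 1) * denomH (α + 2) β γ n := by
  refine (isRecSol_denomH _ _ _).shiftOp_raiseCoeff.ext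
    ((isRecSol_numerH _ _ _).add ((isRecSol_denomH _ _ _).const_mul _)) ?_ ?_ <;>
  · simp [shiftOp, raiseCoeff, numerH, denomH, recSol, coeffA_apply]
    try ring

theorem shiftOp_numerH' (α β γ : ℂ) : shiftOp (raiseCoeff' α β γ) (numerH α β γ) =
    fun n => (2 * γ - α + 1) * (2 * γ - β + 1) * numerH α β (γ + 1) n := by
  refine (isRecSol_numerH _ _ _).shiftOp_raiseCoeff'.ext ((isRecSol_numerH _ _ _).const_mul _) ?_ ?_ <;>
  · simp [shiftOp, raiseCoeff', numerH, recSol, coeffA_apply, coeffB_apply]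
    try ring

theorem shiftOp_denomH' (α β γ : ℂ) : shiftOp (raiseCoeff' α β γ) (denomH α β γ) =
    fun n => numerH α β (γ + 1) n +
      2 * (γ + 1) * (2 * γ - α - β + 1) * denomH α β (γ + 1) n := by
  refine (isRecSol_denomH _ _ _).shiftOp_raiseCoeff'.ext
    ((isRecSol_numerH _ _ _).add ((isRecSol_denomH _ _ _).const_mul _)) ?_ ?_ <;>
  · simp [shiftOp, raiseCoeff', numerH, denomH, recSol, coeffA_apply]
    try ring

theorem natCast_pow_isBigO_sq {k : ℕ} (hk : k ≤ 2) :
    (fun n : ℕ => (n : ℂ) ^ k) =O[atTop] fun n => (n : ℝ) ^ 2 := by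
  refine IsBigO.of_bound 1 ?_
  filter_upwards [eventually_ge_atTop 1] with n hn
  simp only [norm_pow, Complex.norm_natCast, Real.norm_natCast, one_mul]
  exact pow_le_pow_right₀ (by exact_mod_cast hn) hk

theorem quadratic_isBigO (u v w : ℂ) :
    (fun n : ℕ => u * (n : ℂ) ^ 2 + v * n + w) =O[atTop] fun n => (n : ℝ) ^ 2 := by
  have h1 := (natCast_pow_isBigO_sq (k := 1) (by norm_num)).const_mul_left v
  have h0 := (natCast_pow_isBigO_sq (k := 0) (by norm_num)).const_mul_left w
  simpa using (((natCast_pow_isBigO_sq le_rfl).const_mul_left u).add h1).add h0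

theorem raiseCoeff_isBigO (α β γ : ℂ) :
    raiseCoeff α β γ =O[atTop] fun n => (n : ℝ) ^ 2 := by
  refine (quadratic_isBigO (-1) (-2 * γ - 1)
    ((α + 1) * (α + β - 2 * γ + 1) - (1 + α) * (1 + β))).congr_left fun n => ?_
  simp only [raiseCoeff, coeffA_apply]
  ring

theorem raiseCoeff'_isBigO (α β γ : ℂ) :
    raiseCoeff' α β γ =O[atTop] fun n => (n : ℝ) ^ 2 := by
  refine (quadratic_isBigO (-2) (2 * γ - 2 - 2 * α - 2 * β)
    ((2 * γ - α + 1) * (2 * γ - β + 1) - (1 + α) * (1 + β))).congr_left fun n => ?_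
  simp only [raiseCoeff', coeffA_apply]
  ring

theorem IsSlow.shiftOp {g X : ℕ → ℂ} (hg : g =O[atTop] fun n => (n : ℝ) ^ 2)
    (hX : IsSlow (factScaled X)) : IsSlow (factScaled (shiftOp g X)) := by
  have h1 : IsSlow fun n : ℕ => (1 * (n : ℂ) ^ 2 + 2 * n + 1) * factScaled X (n + 1) :=
    hX.succ.mul_isBigO (quadratic_isBigO 1 2 1)
  convert h1.add (hX.mul_isBigO hg) using 2 with n
  have h2 : (n : ℂ) + 1 ≠ 0 := by exact_mod_cast (by omega : n + 1 ≠ 0)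
  have h3 : (n.factorial : ℂ) ≠ 0 := by exact_mod_cast n.factorial_ne_zero
  simp only [factScaled, _root_.shiftOp, Nat.factorial_succ]
  push_cast
  field_simp
  ring

theorem factScaled_const_mul (c : ℂ) (X : ℕ → ℂ) :
    factScaled (fun n => c * X n) = fun n => c * factScaled X n := by
  funext n
  simp only [factScaled]
  ring

theorem isSlow_const_mul_iff {c : ℂ} (hc : c ≠ 0) {X : ℕ → ℂ} :
    IsSlow (factScaled fun n => c * X n) ↔ IsSlow (factScaled X) := by
  rw [factScaled_const_mul]
  refine ⟨fun h => ?_, fun h => h.const_mul c⟩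
  simpa [hc] using h.const_mul c⁻¹

/-- The relation between the values of two continued fractions that is induced by an operator
sending `A'` to `s A` and `B'` to `A + t B`: it sends the slow solution `B' - h' A'` to
`(1 + t h - s h') A + t (B - h A)`, so that the coefficient of the dominant `A` vanishes. -/
theorem relation_of_shiftOp {g A B A' B' : ℕ → ℂ} {h h' s t : ℂ}
    (hg : g =O[atTop] fun n => (n : ℝ) ^ 2)
    (hA : shiftOp g A' = fun n => s * A n) (hB : shiftOp g B' = fun n => A n + t * B n)
    (hA0 : ¬ IsSlow (factScaled A)) (hs : IsSlow (factScaled fun n => B n - h * A n))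
    (hs' : IsSlow (factScaled fun n => B' n - h' * A' n)) :
    t * h - s * h' + 1 = 0 := by
  by_contra hne
  refine hA0 ((isSlow_const_mul_iff hne).1 ?_)
  convert (hs'.shiftOp hg).add (hs.const_mul (-t)) using 2 with n
  have e1 := congrFun hA n
  have e2 := congrFun hB n
  have e3 : shiftOp g (fun n => B' n - h' * A' n) n = shiftOp g B' n - h' * shiftOp g A' n := by
    simp only [shiftOp]; ring
  simp only [factScaled, e3, e1, e2]
  ring

theorem coeffA_comm (α β : ℂ) : coeffA α β = coeffA β α := by
  funext n; simp only [coeffA_apply]; ring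

theorem coeffB_comm (α β γ : ℂ) : coeffB α β γ = coeffB β α γ := by
  funext n; simp only [coeffB_apply]; ring

theorem numerH_comm (α β γ : ℂ) : numerH α β γ = numerH β α γ := by
  rw [numerH, numerH, coeffA_comm, coeffB_comm]

theorem isSlow_numerH_add_two {α β γ : ℂ} (h1 : α + 1 ≠ 0) (h2 : α + β - 2 * γ + 1 ≠ 0)
    (hs : IsSlow (factScaled (numerH α β γ))) : IsSlow (factScaled (numerH (α + 2) β γ)) := by
  have := hs.shiftOp (raiseCoeff_isBigO α β γ)
  rw [shiftOp_numerH] at this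
  exact (isSlow_const_mul_iff (mul_ne_zero h1 h2)).1 this

/-- Slowness of the numerators would persist as `α` and `β` are increased by even integers. -/
theorem isSlow_numerH_add {α β γ : ℂ} (hα : ∀ k : ℕ, (α + 1) / 2 ≠ -(k : ℂ))
    (hβ : ∀ k : ℕ, (β + 1) / 2 ≠ -(k : ℂ)) (hαβγ : ∀ k : ℕ, (α + β + 1) / 2 - γ ≠ -(k : ℂ))
    (hs : IsSlow (factScaled (numerH α β γ))) (N : ℕ) :
    IsSlow (factScaled (numerH (α + 2 * N) (β + 2 * N) γ)) := by
  induction N with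
  | zero => simpa using hs
  | succ N ih =>
    have i1 := isSlow_numerH_add_two (fun h => hα N (by linear_combination h / 2))
      (fun h => hαβγ (2 * N) (by push_cast; linear_combination h / 2)) ih
    rw [numerH_comm] at i1
    have i2 := isSlow_numerH_add_two (fun h => hβ N (by linear_combination h / 2))
      (fun h => hαβγ (2 * N + 1) (by push_cast; linear_combination h / 2)) i1
    rw [numerH_comm] at i2
    convert i2 using 3 <;> push_cast <;> ring

/-! ### Large parameters -/

/-- Worpitzky's criterion: if `4 ‖b (n + 1)‖ ≤ ‖a n‖ ‖a (n + 1)‖`, then every quotient of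
successive numerators is at least half as large as the partial denominator. -/
theorem norm_le_norm_recSol_succ {a b : ℕ → ℂ} (ha : ∀ n, a n ≠ 0)
    (hab : ∀ n, 4 * ‖b (n + 1)‖ ≤ ‖a n‖ * ‖a (n + 1)‖) (n : ℕ) :
    recSol a b 1 (a 0) n ≠ 0 ∧
      ‖a n‖ / 2 * ‖recSol a b 1 (a 0) n‖ ≤ ‖recSol a b 1 (a 0) (n + 1)‖ := by
  induction n with
  | zero =>
    refine ⟨one_ne_zero, ?_⟩
    simp only [recSol, norm_one]
    linarith [norm_nonneg (a 0)]
  | succ n ih =>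
    obtain ⟨h0, h1⟩ := ih
    set x := recSol a b 1 (a 0) n
    set y := recSol a b 1 (a 0) (n + 1)
    have hx : 0 < ‖x‖ := norm_pos_iff.2 h0
    have han : 0 < ‖a n‖ := norm_pos_iff.2 (ha n)
    refine ⟨norm_pos_iff.1 (lt_of_lt_of_le (by positivity) h1), ?_⟩
    have e : recSol a b 1 (a 0) (n + 1 + 1) = a (n + 1) * y + b (n + 1) * x := rfl
    have h2 : ‖a (n + 1)‖ * ‖y‖ ≤ ‖a (n + 1) * y + b (n + 1) * x‖ + ‖b (n + 1)‖ * ‖x‖ := by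
      rw [← norm_mul, ← norm_mul]
      simpa using norm_sub_le (a (n + 1) * y + b (n + 1) * x) (b (n + 1) * x)
    have h3 := mul_le_mul_of_nonneg_right (hab n) hx.le
    have h4 := mul_le_mul_of_nonneg_left h1 (norm_nonneg (a (n + 1)))
    rw [e]
    linarith

/-- Under Worpitzky's criterion the ratios of the scaled numerators eventually exceed
`29 / 20`, just below the limit `3 / 2` of half the scaled partial denominators. This rules out
the slow alternative of `isSlow_or_tendsto_ratio`. -/
theorem not_isSlow_numerH_of_le {α β γ : ℂ} (ha : ∀ n, coeffA α β n ≠ 0)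
    (hab : ∀ n, 4 * ‖coeffB α β γ (n + 1)‖ ≤ ‖coeffA α β n‖ * ‖coeffA α β (n + 1)‖) :
    ¬ IsSlow (factScaled (numerH α β γ)) := by
  have hw := norm_le_norm_recSol_succ ha hab
  have hA := (isRecSol_numerH α β γ).factScaled
  have hlim := tendsto_coeffA_scaled α β
  have hne : ∀ n, factScaled (numerH α β γ) n ≠ 0 := fun n =>
    div_ne_zero (hw n).1 (by exact_mod_cast pow_ne_zero 2 n.factorial_ne_zero)
  suffices hbig : ∀ᶠ n in atTop, 29 / 20 * ‖factScaled (numerH α β γ) n‖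
      ≤ ‖factScaled (numerH α β γ) (n + 1)‖ by
    obtain ⟨h0, h2⟩ := (isSlow_or_tendsto_ratio hlim (tendsto_coeffB_scaled α β γ) hA).resolve_left
      (not_isBigO_pow_of_le_norm_succ (by norm_num) (by norm_num) (Eventually.of_forall hne) hbig)
    exact not_isSlow_of_tendsto_ratio h0 h2
  rw [← map_add_atTop_eq_nat 1, eventually_map]
  filter_upwards [hlim.norm.eventually_const_lt (u := 29 / 10) (by norm_num)] with n hn
  have h3 : (0 : ℝ) < ‖(n : ℂ) + 2‖ := norm_pos_iff.2 (by exact_mod_cast (by omega : n + 2 ≠ 0))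
  have h4 : (0 : ℝ) < ‖((n + 1).factorial : ℂ)‖ :=
    norm_pos_iff.2 (by exact_mod_cast (n + 1).factorial_ne_zero)
  rw [norm_div, norm_pow, lt_div_iff₀ (by positivity)] at hn
  have h5 : ‖coeffA α β (n + 1)‖ / 2 * ‖numerH α β γ (n + 1)‖ ≤ ‖numerH α β γ (n + 1 + 1)‖ :=
    (hw (n + 1)).2
  simp only [factScaled, Nat.factorial_succ (n + 1), norm_div, norm_pow, Nat.cast_mul, norm_mul]
  rw [show ((n + 1 + 1 : ℕ) : ℂ) = n + 2 by push_cast; ring, mul_pow, ← mul_div_assoc,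
    div_le_div_iff₀ (by positivity) (by positivity)]
  have h6 := mul_le_mul_of_nonneg_right hn.le (norm_nonneg (numerH α β γ (n + 1)))
  have h7 : 29 / 20 * ‖numerH α β γ (n + 1)‖ * ‖(n : ℂ) + 2‖ ^ 2 ≤ ‖numerH α β γ (n + 1 + 1)‖ := by
    linarith
  rw [← mul_assoc]
  gcongr

theorem le_norm_coeffA_add {α β : ℂ} {K M : ℝ} (hK : 1 ≤ K) (hα : ‖α‖ ≤ K) (hβ : ‖β‖ ≤ K)
    (hM : 1 ≤ M) (n : ℕ) :
    (n + M) * (3 * n + M - 20 * K ^ 2) ≤ ‖coeffA (α + M) (β + M) n‖ := by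
  have e : (((n + M) * (3 * n + M) : ℝ) : ℂ) = coeffA (α + M) (β + M) n
      - (((3 * n + 1 + 2 * M : ℝ) : ℂ) + ((2 * n + 1 : ℝ) : ℂ) * (α + β) + (M : ℂ) * (α + β)
        + α * β) := by
    rw [coeffA_apply]
    push_cast
    ring
  have hn : (0 : ℝ) ≤ n := n.cast_nonneg
  have hab : ‖α + β‖ ≤ 2 * K := (norm_add_le _ _).trans (by linarith)
  have b : ‖((3 * n + 1 + 2 * M : ℝ) : ℂ) + ((2 * n + 1 : ℝ) : ℂ) * (α + β) + (M : ℂ) * (α + β)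
      + α * β‖ ≤ (3 * n + 1 + 2 * M) + (2 * n + 1) * (2 * K) + M * (2 * K) + K * K := by
    refine (norm_add_le _ _).trans (add_le_add ((norm_add_le _ _).trans (add_le_add
      ((norm_add_le _ _).trans (add_le_add ?_ ?_)) ?_)) ?_)
    · rw [Complex.norm_real, Real.norm_of_nonneg (by positivity)]
    · rw [norm_mul, Complex.norm_real, Real.norm_of_nonneg (by positivity)]
      gcongr
    · rw [norm_mul, Complex.norm_real, Real.norm_of_nonneg (by positivity)]
      gcongr
    · rw [norm_mul]
      gcongr
  have h1 : (n + M) * (3 * n + M) ≤ ‖coeffA (α + M) (β + M) n‖ + ((3 * n + 1 + 2 * M)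
      + (2 * n + 1) * (2 * K) + M * (2 * K) + K * K) := by
    have h2 := norm_sub_le (coeffA (α + M) (β + M) n)
      (((3 * n + 1 + 2 * M : ℝ) : ℂ) + ((2 * n + 1 : ℝ) : ℂ) * (α + β) + (M : ℂ) * (α + β) + α * β)
    rw [← e, Complex.norm_real, Real.norm_of_nonneg (by positivity)] at h2
    linarith
  have hKK : K ≤ K ^ 2 := by nlinarith
  have h3 : n ≤ n * K ^ 2 := by nlinarith
  have h4 : n * K ≤ n * K ^ 2 := by gcongr
  have h5 : M ≤ M * K ^ 2 := by nlinarith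
  have h6 : M * K ≤ M * K ^ 2 := by gcongr
  have h7 : K ^ 2 ≤ M * K ^ 2 := by nlinarith
  nlinarith

theorem norm_coeffB_add_le {α β γ : ℂ} {K M : ℝ} (hα : ‖α‖ ≤ K) (hβ : ‖β‖ ≤ K) (hγ : ‖γ‖ ≤ K)
    (hM : 1 ≤ M) (n : ℕ) :
    ‖coeffB (α + M) (β + M) γ (n + 1)‖ ≤ 2 * (n + 1 + K) ^ 2 * (n + 1 + M + K) ^ 2 := by
  have hK : 0 ≤ K := (norm_nonneg _).trans hα
  have hn : (0 : ℝ) ≤ n := n.cast_nonneg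
  have hb : ∀ {z : ℂ} {r : ℝ}, ‖z‖ ≤ K → 0 ≤ r → ‖(r : ℂ) + z‖ ≤ r + K := fun hz hr =>
    (norm_add_le _ _).trans (add_le_add (by rw [Complex.norm_real, Real.norm_of_nonneg hr]) hz)
  have e : coeffB (α + M) (β + M) γ (n + 1) = -2 * (((n + 1 : ℝ) : ℂ) + 0)
      * (((n + 1 + M : ℝ) : ℂ) + α) * (((n + 1 + M : ℝ) : ℂ) + β) * (((n + 1 : ℝ) : ℂ) + γ) := by
    rw [coeffB_apply]
    push_cast
    ring
  rw [e, norm_mul, norm_mul, norm_mul, norm_mul]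
  calc _ ≤ 2 * (n + 1 + K) * (n + 1 + M + K) * (n + 1 + M + K) * (n + 1 + K) := by
        gcongr
        · simp
        · exact hb (by simpa using hK) (by positivity)
        · exact hb hα (by positivity)
        · exact hb hβ (by positivity)
        · exact hb hγ (by positivity)
    _ = _ := by ring

/-- For `α` and `β` with large real part the continued fraction satisfies Worpitzky's criterion,
so its numerators are dominant. -/
theorem exists_not_isSlow_numerH_add (α β γ : ℂ) :
    ∃ N : ℕ, ¬ IsSlow (factScaled (numerH (α + 2 * N) (β + 2 * N) γ)) := by
  obtain ⟨K, hK1, hα, hβ, hγ⟩ : ∃ K : ℝ, 1 ≤ K ∧ ‖α‖ ≤ K ∧ ‖β‖ ≤ K ∧ ‖γ‖ ≤ K :=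
    ⟨1 + ‖α‖ + ‖β‖ + ‖γ‖, by linarith [norm_nonneg α, norm_nonneg β, norm_nonneg γ],
      by linarith [norm_nonneg β, norm_nonneg γ], by linarith [norm_nonneg α, norm_nonneg γ],
      by linarith [norm_nonneg α, norm_nonneg β]⟩
  obtain ⟨N, hN⟩ := exists_nat_ge (20 * K ^ 2 + 40 * (1 + K))
  refine ⟨N, ?_⟩
  obtain ⟨M, hMN⟩ : ∃ M : ℝ, M = 2 * N := ⟨_, rfl⟩
  have hM : 20 * K ^ 2 + 40 * (1 + K) ≤ M := by
    have : (0 : ℝ) ≤ N := N.cast_nonneg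
    linarith
  have hM1 : 1 ≤ M := by nlinarith
  have hcast : (2 * N : ℂ) = (M : ℂ) := by rw [hMN]; push_cast; ring
  rw [hcast]
  have hA := le_norm_coeffA_add hK1 hα hβ hM1
  have hw : ∀ n : ℕ, 29 / 10 * (n + 1 + K) ≤ 3 * n + M - 20 * K ^ 2 := fun n => by
    have : (0 : ℝ) ≤ n := n.cast_nonneg
    linarith
  have hpos : ∀ n : ℕ, (n + M) * (29 / 10 * (n + 1 + K)) ≤ ‖coeffA (α + M) (β + M) n‖ := fun n =>
    (mul_le_mul_of_nonneg_left (hw n) (by positivity)).trans (hA n)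
  refine not_isSlow_numerH_of_le (fun n => ?_) fun n => ?_
  · exact norm_pos_iff.1 (lt_of_lt_of_le (by positivity) (hpos n))
  have hn : (0 : ℝ) ≤ n := n.cast_nonneg
  have h1 : (n + M) * (29 / 10 * (n + 1 + K)) ≤ ‖coeffA (α + M) (β + M) (n + 1)‖ := by
    refine le_trans ?_ (hpos (n + 1))
    push_cast
    gcongr <;> linarith
  have h2 : n + 1 + M + K ≤ 41 / 40 * (n + M) := by
    have : 0 ≤ K ^ 2 := sq_nonneg K
    linarith
  -- The constants fit because `8 * (41 / 40) ^ 2 ≤ (29 / 10) ^ 2`.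
  calc 4 * ‖coeffB (α + M) (β + M) γ (n + 1)‖
      ≤ 4 * (2 * (n + 1 + K) ^ 2 * (n + 1 + M + K) ^ 2) := by
        gcongr; exact norm_coeffB_add_le hα hβ hγ hM1 n
    _ ≤ 4 * (2 * (n + 1 + K) ^ 2 * (41 / 40 * (n + M)) ^ 2) := by gcongr
    _ = 8 * (41 / 40) ^ 2 * ((n + 1 + K) * (n + M)) ^ 2 := by ring
    _ ≤ (29 / 10) ^ 2 * ((n + 1 + K) * (n + M)) ^ 2 := by gcongr; norm_num
    _ = ((n + M) * (29 / 10 * (n + 1 + K))) * ((n + M) * (29 / 10 * (n + 1 + K))) := by ring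
    _ ≤ ‖coeffA (α + M) (β + M) n‖ * ‖coeffA (α + M) (β + M) (n + 1)‖ :=
        mul_le_mul (hpos n) h1 (by positivity) (norm_nonneg _)

/-! ### The contiguity relations for `H` -/

/-- The numerators are dominant under the first, second and fourth conditions on the parameters
alone; at `γ - 1` the third one may fail. -/
theorem not_isSlow_numerH {α β γ : ℂ} (hα : ∀ k : ℕ, (α + 1) / 2 ≠ -(k : ℂ))
    (hβ : ∀ k : ℕ, (β + 1) / 2 ≠ -(k : ℂ)) (hαβγ : ∀ k : ℕ, (α + β + 1) / 2 - γ ≠ -(k : ℂ)) :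
    ¬ IsSlow (factScaled (numerH α β γ)) := fun hs =>
  let ⟨N, hN⟩ := exists_not_isSlow_numerH_add α β γ
  hN (isSlow_numerH_add hα hβ hαβγ hs N)

theorem theorem2p2 (α β γ : ℂ)
    (hα : ∀ k : ℕ, (α + 1) / 2 ≠ -(k : ℂ))
    (hβ : ∀ k : ℕ, (β + 1) / 2 ≠ -(k : ℂ))
    (hγ : ∀ k : ℕ, γ + 1 ≠ -(k : ℂ))
    (hαβγ : ∀ k : ℕ, (α + β + 1) / 2 - γ ≠ -(k : ℂ)) :
    HIsDefined α β γ ∧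
    (α ≠ 1 → α + β - 2 * γ ≠ 1 →
      HIsDefined (α - 2) β γ ∧
      α * (α - 2 * γ - 1) * H α β γ
        - (α - 1) * (α + β - 2 * γ - 1) * H (α - 2) β γ + 1 = 0) ∧
    (HIsDefined α β (γ - 1) ∧
      2 * γ * (2 * γ - α - β - 1) * H α β γ
        - (2 * γ - α - 1) * (2 * γ - β - 1) * H α β (γ - 1) + 1 = 0) := by
  have hA := not_isSlow_numerH hα hβ hαβγ
  obtain ⟨hdef, hs⟩ := hIsDefined_of_not_isSlow hA
  refine ⟨hdef, fun h1 h2 => ?_, ?_⟩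
  · have hA' : ¬ IsSlow (factScaled (numerH (α - 2) β γ)) := by
      refine not_isSlow_numerH (fun k hk => ?_) hβ fun k hk => ?_
      · cases k with
        | zero => exact h1 (by push_cast at hk; linear_combination 2 * hk)
        | succ k => exact hα k (by push_cast at hk; linear_combination hk)
      · cases k with
        | zero => exact h2 (by push_cast at hk; linear_combination 2 * hk)
        | succ k => exact hαβγ k (by push_cast at hk; linear_combination hk)
    obtain ⟨hdef', hs'⟩ := hIsDefined_of_not_isSlow hA'
    refine ⟨hdef', ?_⟩
    have eA := shiftOp_numerH (α - 2) β γ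
    have eB := shiftOp_denomH (α - 2) β γ
    rw [sub_add_cancel] at eA eB
    linear_combination relation_of_shiftOp (raiseCoeff_isBigO _ _ _) eA eB hA hs hs'
  · have hA' : ¬ IsSlow (factScaled (numerH α β (γ - 1))) :=
      not_isSlow_numerH hα hβ fun k hk =>
        hαβγ (k + 1) (by push_cast; linear_combination hk)
    obtain ⟨hdef', hs'⟩ := hIsDefined_of_not_isSlow hA'
    refine ⟨hdef', ?_⟩
    have eA := shiftOp_numerH' α β (γ - 1)
    have eB := shiftOp_denomH' α β (γ - 1)
    rw [sub_add_cancel] at eA eB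
    linear_combination relation_of_shiftOp (raiseCoeff'_isBigO _ _ _) eA eB hA hs hs'
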